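/- Let $(\Omega,\mathcal F)$ be a measurable space with a sequence of real random variables $X_1,X_2,\dots$, and let $\overline{\mathcal P}$ be the family of all probability measures $P$ on $(\Omega,\mathcal F)$ under which $X_1,X_2,\dots$ are i.i.d., integrable and have expected value zero. Write $S_k=\sum_{i=1}^k X_i$, $\hat\mu_k=\frac1k\sum_{i=1}^k X_i$, $\hat\sigma_k^2=\frac1k\sum_{i=1}^k (X_i-\hat\mu_k)^2$ with $\hat\sigma_k\ge 0$, and $\sigma_P^2=\mathrm{Var}_P[X_1]$. Let $\mathcal P\subseteq\overline{\mathcal P}$. (a) Suppose that the second moment of $X_1$ is uniformly integrable over $\mathcal P$, i.e. $\lim_{x\to\infty}\sup_{P\in\mathcal P} E_P\big[X_1^2\,\mathbf 1\{X_1^2\ge x\}\big]=0$. Then there is $\bar\sigma\in(0,\infty)$ with $\sup_{P\in\mathcal P}\mathrm{Var}_P[X_1]\le\bar\sigma^2$, and for every such $\bar\sigma$ and every $\delta>0$, $$\lim_{m\to\infty}\ \sup_{P\in\mathcal P} P\left[\sup_{k\ge m}\frac{|S_k/\bar\sigma|}{\sqrt{2k\log\log k}}\ge 1+\delta\right]=0.$$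 (b) Suppose that $\sigma_P^2<\infty$ for every $P\in\mathcal P$ and that the second moment of $X_1/\sigma_P$ is uniformly integrable over $\mathcal P$, i.e. $\lim_{x\to\infty}\sup_{P\in\mathcal P} E_P\big[\tfrac{X_1^2}{\sigma_P^2}\,\mathbf 1\{\tfrac{X_1^2}{\sigma_P^2}\ge x\}\big]=0$. Then for every $\delta>0$, $$\lim_{m\to\infty}\ \sup_{P\in\mathcal P} P\left[\sup_{k\ge m}\frac{|S_k/\hat\sigma_k|}{\sqrt{2k\log\log k}}\ge 1+\delta\right]=0.$$ Here suprema over $k$ take values in $[0,\infty]$, a supremum over the empty family is $0$, and the quotient $|S_k/\hat\sigma_k|$ is $\infty$ if $\hat\sigma_k=0\ne S_k$ and $0$ if $\hat\sigma_k=0=S_k$. If $\sigma_P=0$ (so that $X_1=0$ $P$-almost surely), $X_1/\sigma_P$ is read as $0$. -/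

import Mathlib

open MeasureTheory ProbabilityTheory Filter Topology
open scoped ENNReal

noncomputable section

variable {Ω : Type*} [MeasurableSpace Ω]

/-- The family of all probability measures under which `X 0, X 1, X 2, …` (the random variables
written `X_1, X_2, X_3, …` on paper) are i.i.d., integrable and have expected value zero. -/
def centeredIIDLaws (X : ℕ → Ω → ℝ) : Set (Measure Ω) :=
  {P | IsProbabilityMeasure P ∧ iIndepFun X P ∧ (∀ i, IdentDistrib (X i) (X 0) P P) ∧
    (∀ i, Integrable (X i) P) ∧ ∀ i, ∫ ω, X i ω ∂P = 0}

/-- `S_k = X_1 + ⋯ + X_k`. -/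
def partialSum (X : ℕ → Ω → ℝ) (k : ℕ) (ω : Ω) : ℝ :=
  ∑ i ∈ Finset.range k, X i ω

/-- The sample mean of the first `k` observations. -/
def sampleMean (X : ℕ → Ω → ℝ) (k : ℕ) (ω : Ω) : ℝ :=
  (1 / (k : ℝ)) * ∑ i ∈ Finset.range k, X i ω

/-- The sample variance of the first `k` observations (normalised by `k`). -/
def sampleVariance (X : ℕ → Ω → ℝ) (k : ℕ) (ω : Ω) : ℝ :=
  (1 / (k : ℝ)) * ∑ i ∈ Finset.range k, (X i ω - sampleMean X k ω) ^ 2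

/-- The sample standard deviation of the first `k` observations. -/
def sampleStd (X : ℕ → Ω → ℝ) (k : ℕ) (ω : Ω) : ℝ :=
  √(sampleVariance X k ω)

/-- The truncated second moment `E_P[Y² 1{Y² ≥ x}]`, with values in `[0, ∞]`. -/
def truncatedSecondMoment (Y : Ω → ℝ) (P : Measure Ω) (x : ℝ) : ℝ≥0∞ :=
  ∫⁻ ω in {ω | x ≤ Y ω ^ 2}, ENNReal.ofReal (Y ω ^ 2) ∂P

/-- The second moment of `Y` is uniformly integrable over the family `Laws`; the random variable
`Y P` may depend on the measure `P ∈ Laws`. -/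
def HasUniformlyIntegrableSecondMoment (Laws : Set (Measure Ω)) (Y : Measure Ω → Ω → ℝ) : Prop :=
  Tendsto (fun x : ℝ => ⨆ P ∈ Laws, truncatedSecondMoment (Y P) P x) atTop (𝓝 0)

/-- The event `sup_{k ≥ m} |S_k / s_k| / √(2 k log log k) ≥ 1 + δ`. The quotients and the supremum
are taken in `[0, ∞]`, so that `a / 0 = ∞` for `a > 0` while `0 / 0 = 0`, and an unbounded
supremum is `∞`. -/
def lilExceedance (X : ℕ → Ω → ℝ) (s : ℕ → Ω → ℝ) (δ : ℝ) (m : ℕ) : Set Ω :=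
  {ω | ENNReal.ofReal (1 + δ) ≤
    ⨆ k : ℕ, ⨆ _ : m ≤ k, ENNReal.ofReal |partialSum X k ω| / ENNReal.ofReal (s k ω) /
      ENNReal.ofReal √(2 * k * Real.log (Real.log k))}

/-- The upper bound of the law of the iterated logarithm for `S_k / s_k`, uniformly in `Laws`. -/
def UniformLIL (Laws : Set (Measure Ω)) (X : ℕ → Ω → ℝ) (s : ℕ → Ω → ℝ) : Prop :=
  ∀ δ : ℝ, 0 < δ →
    Tendsto (fun m : ℕ => ⨆ P ∈ Laws, P (lilExceedance X s δ m)) atTop (𝓝 0)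

end

/-! ### Exponential maximal inequalities for bounded independent variables -/

section MaximalInequality

/-! Rescale so that the second moment is at most one and cut time into blocks `a ^ j ≤ k < a ^ (j +
1)` with `a` slightly above 1. On a block, truncate at a small multiple of `√(a ^ j / log log a ^
j)`. The centred truncated sums obey a Bernstein bound, which Doob's inequality extends to the
maximum over the block (`measure_exists_abs_sum_ge_le`); its probability is of order `j ^ (-(1 +
δ/4))`, summable with no dependence on the law. The truncated-off parts are handled by Markov's
inequality, at cost `T * E|tailPart T X|` per block. As the levels `T` grow geometrically, these
costs sum to a multiple of `E[X²; X² ≥ T²]` at the first level used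
(`tsum_mul_lintegral_tailPart_le`), which uniform integrability makes small uniformly. The union
over blocks is `tendsto_iSup_measure_exists_sum_ge`.

A constant normalisation is then pure rescaling. For the sample standard deviation, rescale by the
true one; it remains to bound the sample variance from below for all large `k` at once. Squares
capped at a level `b` lose little mean, by uniform integrability, and Hoeffding's inequality gives
geometric bounds (`measure_exists_sum_min_sq_le`). The squared sample mean is negligible wherever
the iterated-logarithm bound itself holds. -/

/-- The Taylor remainder `2|x|³/9` is absorbed by `c x²/2`. The factor `1 + c`, close to 1 for small
`c`, preserves the sharp constant `√2`. -/
theorem exp_le_quadratic {x c : ℝ} (hx : |x| ≤ c) (hc : c ≤ 1) :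
    Real.exp x ≤ 1 + x + x ^ 2 / 2 * (1 + c) := by
  have h := (abs_le.1 (Real.exp_bound (hx.trans hc) (n := 3) (by norm_num))).2
  simp only [Finset.sum_range_succ, Finset.sum_range_zero, Nat.factorial] at h
  norm_num at h
  have h3 : |x| ^ 3 = x ^ 2 * |x| := by rw [pow_succ, sq_abs]
  rw [h3] at h
  have : x ^ 2 * |x| ≤ x ^ 2 * c := mul_le_mul_of_nonneg_left hx (sq_nonneg x)
  have : 0 ≤ x ^ 2 * |x| := by positivity
  linarith

theorem abs_sum_range_le_of_abs_le {Ω : Type*} {Z : ℕ → Ω → ℝ} {C : ℝ} (hC : ∀ i ω, |Z i ω| ≤ C) (n : ℕ)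
    (ω : Ω) : |∑ i ∈ Finset.range n, Z i ω| ≤ n * C :=
  (Finset.abs_sum_le_sum_abs _ _).trans
    ((Finset.sum_le_sum fun i _ => hC i ω).trans (by simp))

variable {Ω : Type*} [MeasurableSpace Ω] {P : Measure Ω}

theorem integrable_of_abs_le [IsFiniteMeasure P] {Z : Ω → ℝ} (hZ : Measurable Z) {C : ℝ}
    (hC : ∀ ω, |Z ω| ≤ C) : Integrable Z P :=
  Integrable.of_bound hZ.aestronglyMeasurable C (ae_of_all _ hC)

theorem integrable_exp_mul_of_abs_le [IsFiniteMeasure P] {Z : Ω → ℝ} (hZ : Measurable Z) {C : ℝ}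
    (hC : ∀ ω, |Z ω| ≤ C) (θ : ℝ) : Integrable (fun ω => Real.exp (θ * Z ω)) P :=
  integrable_of_abs_le (by fun_prop) (C := Real.exp (|θ| * C)) fun ω => by
    rw [Real.abs_exp]
    refine Real.exp_le_exp.2 ((le_abs_self _).trans ?_)
    rw [abs_mul]
    exact mul_le_mul_of_nonneg_left (hC ω) (abs_nonneg _)

/-- A Bernstein-type bound on the moment generating function of a bounded centred variable. -/
theorem mgf_le_of_abs_le [IsProbabilityMeasure P] {Z : Ω → ℝ} (hZ : Measurable Z) {C v c θ : ℝ}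
    (hC : ∀ ω, |Z ω| ≤ C) (hmean : ∫ ω, Z ω ∂P = 0) (hv : ∫ ω, Z ω ^ 2 ∂P ≤ v) (hθ : 0 ≤ θ)
    (hc : θ * C ≤ c) (hc1 : c ≤ 1) : mgf Z P θ ≤ Real.exp (θ ^ 2 * v / 2 * (1 + c)) := by
  have hC0 : 0 ≤ C := by
    obtain ⟨ω⟩ := nonempty_of_isProbabilityMeasure P
    exact (abs_nonneg _).trans (hC ω)
  have hc0 : 0 ≤ c := (mul_nonneg hθ hC0).trans hc
  have hi := integrable_of_abs_le (P := P) hZ hC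
  have hi2 : Integrable (fun ω => Z ω ^ 2) P :=
    integrable_of_abs_le (by fun_prop) (C := C ^ 2) fun ω => by
      rw [abs_pow]; exact pow_le_pow_left₀ (abs_nonneg _) (hC ω) 2
  have h1 : mgf Z P θ ≤ ∫ ω, (1 + θ * Z ω + θ ^ 2 * (1 + c) / 2 * Z ω ^ 2) ∂P := by
    refine integral_mono (integrable_exp_mul_of_abs_le hZ hC θ)
      (((integrable_const _).add (hi.const_mul _)).add (hi2.const_mul _)) fun ω => ?_
    have := exp_le_quadratic (x := θ * Z ω) (c := c) (by
      rw [abs_mul, abs_of_nonneg hθ]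
      exact (mul_le_mul_of_nonneg_left (hC ω) hθ).trans hc) hc1
    simp only
    linarith [this]
  have h0 : Integrable (fun ω => 1 + θ * Z ω) P := (integrable_const _).add (hi.const_mul _)
  rw [integral_add h0 (hi2.const_mul _), integral_add (integrable_const _) (hi.const_mul _),
    integral_const_mul, integral_const_mul, hmean] at h1
  simp only [integral_const, probReal_univ, smul_eq_mul, mul_one, mul_zero, add_zero] at h1
  have h2 : θ ^ 2 * (1 + c) / 2 * ∫ ω, Z ω ^ 2 ∂P ≤ θ ^ 2 * (1 + c) / 2 * v :=
    mul_le_mul_of_nonneg_left hv (by positivity)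
  have h3 := Real.add_one_le_exp (θ ^ 2 * v / 2 * (1 + c))
  linarith

/-- The exponentials of the partial sums of bounded centred independent variables form a
submartingale. -/
theorem submartingale_exp_sum {Z : ℕ → Ω → ℝ} (hZ : ∀ i, Measurable (Z i))
    (hind : iIndepFun Z P) {C : ℝ} (hC : ∀ i ω, |Z i ω| ≤ C) (hmean : ∀ i, ∫ ω, Z i ω ∂P = 0)
    (θ : ℝ) :
    Submartingale (fun n ω => Real.exp (θ * ∑ i ∈ Finset.range (n + 1), Z i ω))
      (Filtration.natural Z fun i => (hZ i).stronglyMeasurable) P := by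
  have : IsProbabilityMeasure P := hind.isProbabilityMeasure
  set 𝒢 := Filtration.natural Z fun i => (hZ i).stronglyMeasurable with h𝒢
  -- Time `n` carries `n + 1` summands because `𝒢 n` is generated by `Z 0, …, Z n`.
  have hadp : ∀ n, Measurable[𝒢 n] fun ω => Real.exp (θ * ∑ i ∈ Finset.range (n + 1), Z i ω) := by
    intro n
    have hZn : ∀ i ∈ Finset.range (n + 1), Measurable[𝒢 n] (Z i) := fun i hi =>
      ((Filtration.stronglyAdapted_natural fun i => (hZ i).stronglyMeasurable).stronglyMeasurable_le
        (Nat.lt_succ_iff.1 (Finset.mem_range.1 hi))).measurable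
    have hs : Measurable[𝒢 n] fun ω => ∑ i ∈ Finset.range (n + 1), Z i ω :=
      Finset.measurable_sum _ hZn
    exact Real.measurable_exp.comp (hs.const_mul θ)
  have hmeas : ∀ n, Measurable fun ω => ∑ i ∈ Finset.range n, Z i ω := fun n =>
    Finset.measurable_sum _ fun i _ => hZ i
  have hint : ∀ n, Integrable (fun ω => Real.exp (θ * ∑ i ∈ Finset.range n, Z i ω)) P := fun n =>
    integrable_exp_mul_of_abs_le (hmeas n) (abs_sum_range_le_of_abs_le hC n) θ
  refine submartingale_of_setIntegral_le_succ (fun n => (hadp n).stronglyMeasurable)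
    (fun n => hint (n + 1)) fun n s hs => ?_
  have hs' : MeasurableSet s := 𝒢.le n s hs
  rw [← integral_indicator hs', ← integral_indicator hs']
  -- `U` is `𝒢 n`-measurable and the next factor is independent of it, so the integral over `s`
  -- splits; the new factor has mean at least 1 since `exp x ≥ 1 + x`.
  set U : Ω → ℝ := s.indicator fun ω => Real.exp (θ * ∑ i ∈ Finset.range (n + 1), Z i ω) with hU
  have hUm : Measurable[𝒢 n] U := (hadp n).indicator hs
  have hUm' : Measurable U := hUm.mono (𝒢.le n) le_rfl
  have hV : Measurable fun ω => Real.exp (θ * Z (n + 1) ω) := by have := hZ (n + 1); fun_prop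
  have hUV : IndepFun U (fun ω => Real.exp (θ * Z (n + 1) ω)) P := by
    rw [IndepFun_iff_Indep]
    refine indep_of_indep_of_le_right (indep_of_indep_of_le_left
      (hind.indep_comap_natural_of_lt (fun i => (hZ i).stronglyMeasurable)
        (Nat.lt_succ_self n)).symm hUm.comap_le) ?_
    exact ((Real.measurable_exp.comp (measurable_const_mul θ)).comp (comap_measurable _)).comap_le
  have h1 : (s.indicator fun ω => Real.exp (θ * ∑ i ∈ Finset.range (n + 1 + 1), Z i ω)) =
      fun ω => U ω * Real.exp (θ * Z (n + 1) ω) := by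
    ext ω
    by_cases h : ω ∈ s
    · simp only [hU, Set.indicator_of_mem h]
      rw [Finset.sum_range_succ, mul_add, Real.exp_add]
    · simp only [hU, Set.indicator_of_notMem h, zero_mul]
  rw [h1, hUV.integral_fun_mul_eq_mul_integral hUm'.aestronglyMeasurable hV.aestronglyMeasurable]
  have h2 : 1 ≤ ∫ ω, Real.exp (θ * Z (n + 1) ω) ∂P := by
    have hi := integrable_of_abs_le (P := P) (hZ (n + 1)) (hC (n + 1))
    have : ∫ ω, (θ * Z (n + 1) ω + 1) ∂P ≤ ∫ ω, Real.exp (θ * Z (n + 1) ω) ∂P :=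
      integral_mono ((hi.const_mul θ).add (integrable_const 1))
        (integrable_exp_mul_of_abs_le (hZ (n + 1)) (hC (n + 1)) θ)
        fun ω => Real.add_one_le_exp _
    rw [integral_add (hi.const_mul θ) (integrable_const 1), integral_const_mul, hmean] at this
    simpa using this
  exact le_mul_of_one_le_right
    (integral_nonneg fun ω => Set.indicator_nonneg (fun _ _ => (Real.exp_pos _).le) _) h2

/-- An exponential maximal inequality for bounded centred independent variables. -/
theorem measure_exists_sum_ge_le {Z : ℕ → Ω → ℝ} (hZ : ∀ i, Measurable (Z i))
    (hind : iIndepFun Z P) {C : ℝ} (hC : ∀ i ω, |Z i ω| ≤ C) (hmean : ∀ i, ∫ ω, Z i ω ∂P = 0)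
    {θ l : ℝ} (hθ : 0 ≤ θ) (hl : 0 < l) (N : ℕ) :
    P {ω | ∃ k ≤ N, l ≤ ∑ i ∈ Finset.range k, Z i ω} ≤
      ENNReal.ofReal (Real.exp (-(θ * l)) * ∏ i ∈ Finset.range N, mgf (Z i) P θ) := by
  have : IsProbabilityMeasure P := hind.isProbabilityMeasure
  rcases N with _ | n
  · have : {ω | ∃ k ≤ 0, l ≤ ∑ i ∈ Finset.range k, Z i ω} = ∅ := by
      ext ω
      simp [hl]
    rw [this]
    simp
  have hm := maximal_ineq (submartingale_exp_sum hZ hind hC hmean θ)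
    (fun n ω => (Real.exp_pos _).le) (ε := (Real.exp (θ * l)).toNNReal) n
  rw [Real.coe_toNNReal _ (Real.exp_pos _).le] at hm
  set A := {ω | Real.exp (θ * l) ≤
    (Finset.range (n + 1)).sup' Finset.nonempty_range_add_one
      fun k => Real.exp (θ * ∑ i ∈ Finset.range (k + 1), Z i ω)} with hA
  have hsub : {ω | ∃ k ≤ n + 1, l ≤ ∑ i ∈ Finset.range k, Z i ω} ⊆ A := by
    rintro ω ⟨k, hk, hlk⟩
    rcases k with _ | k
    · simp at hlk; linarith
    · rw [hA, Set.mem_ofPred_eq, Finset.le_sup'_iff]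
      refine ⟨k, Finset.mem_range.2 hk, ?_⟩
      exact Real.exp_le_exp.2 (mul_le_mul_of_nonneg_left hlk hθ)
  have hint : Integrable (fun ω => Real.exp (θ * ∑ i ∈ Finset.range (n + 1), Z i ω)) P :=
    integrable_exp_mul_of_abs_le (Finset.measurable_sum _ fun i _ => hZ i)
      (abs_sum_range_le_of_abs_le hC _) θ
  have hle : ∫ ω in A, Real.exp (θ * ∑ i ∈ Finset.range (n + 1), Z i ω) ∂P ≤
      ∏ i ∈ Finset.range (n + 1), mgf (Z i) P θ := by
    rw [← hind.mgf_sum hZ]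
    refine (setIntegral_le_integral hint (ae_of_all _ fun ω => (Real.exp_pos _).le)).trans ?_
    simp [mgf]
  calc P {ω | ∃ k ≤ n + 1, l ≤ ∑ i ∈ Finset.range k, Z i ω} ≤ P A := measure_mono hsub
    _ = ENNReal.ofReal (Real.exp (-(θ * l))) * (ENNReal.ofReal (Real.exp (θ * l)) * P A) := by
      rw [← mul_assoc, ← ENNReal.ofReal_mul (Real.exp_pos _).le, ← Real.exp_add]
      simp
    _ ≤ ENNReal.ofReal (Real.exp (-(θ * l))) *
        ENNReal.ofReal (∏ i ∈ Finset.range (n + 1), mgf (Z i) P θ) := by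
      gcongr
      exact hm.trans (ENNReal.ofReal_le_ofReal hle)
    _ = _ := (ENNReal.ofReal_mul (Real.exp_pos _).le).symm

/-- Two-sided exponential maximal inequality. -/
theorem measure_exists_abs_sum_ge_le {Z : ℕ → Ω → ℝ} (hZ : ∀ i, Measurable (Z i))
    (hind : iIndepFun Z P) {C v c θ l : ℝ} (hC : ∀ i ω, |Z i ω| ≤ C)
    (hmean : ∀ i, ∫ ω, Z i ω ∂P = 0) (hv : ∀ i, ∫ ω, Z i ω ^ 2 ∂P ≤ v)
    (hθ : 0 ≤ θ) (hl : 0 < l) (hc : θ * C ≤ c) (hc1 : c ≤ 1) (N : ℕ) :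
    P {ω | ∃ k ≤ N, l ≤ |∑ i ∈ Finset.range k, Z i ω|} ≤
      ENNReal.ofReal (2 * Real.exp (-(θ * l) + N * (θ ^ 2 * v / 2 * (1 + c)))) := by
  have : IsProbabilityMeasure P := hind.isProbabilityMeasure
  have key : ∀ Z' : ℕ → Ω → ℝ, (∀ i, Measurable (Z' i)) → iIndepFun Z' P →
      (∀ i ω, |Z' i ω| ≤ C) → (∀ i, ∫ ω, Z' i ω ∂P = 0) → (∀ i, ∫ ω, Z' i ω ^ 2 ∂P ≤ v) →
      P {ω | ∃ k ≤ N, l ≤ ∑ i ∈ Finset.range k, Z' i ω} ≤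
        ENNReal.ofReal (Real.exp (-(θ * l) + N * (θ ^ 2 * v / 2 * (1 + c)))) := by
    intro Z' hZ' hi hC' hm' hv'
    refine (measure_exists_sum_ge_le hZ' hi hC' hm' hθ hl N).trans (ENNReal.ofReal_le_ofReal ?_)
    rw [Real.exp_add, Real.exp_nat_mul]
    refine mul_le_mul_of_nonneg_left ?_ (Real.exp_pos _).le
    refine (Finset.prod_le_prod (fun i _ => mgf_nonneg)
      fun i _ => mgf_le_of_abs_le (hZ' i) (hC' i) (hm' i) (hv' i) hθ hc hc1).trans ?_
    simp
  have h1 := key Z hZ hind hC hmean hv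
  have h2 := key (fun i ω => -Z i ω) (fun i => (hZ i).neg)
    (hind.comp (fun _ x => -x) fun _ => measurable_neg) (by simpa using hC)
    (fun i => by rw [integral_neg, hmean, neg_zero]) (by simpa using hv)
  have hsub : {ω | ∃ k ≤ N, l ≤ |∑ i ∈ Finset.range k, Z i ω|} ⊆
      {ω | ∃ k ≤ N, l ≤ ∑ i ∈ Finset.range k, Z i ω} ∪
      {ω | ∃ k ≤ N, l ≤ ∑ i ∈ Finset.range k, -Z i ω} := by
    rintro ω ⟨k, hk, hlk⟩
    rcases le_abs.1 hlk with h | h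
    · exact Or.inl ⟨k, hk, h⟩
    · exact Or.inr ⟨k, hk, by rwa [Finset.sum_neg_distrib]⟩
  refine (measure_mono hsub).trans ((measure_union_le _ _).trans ((add_le_add h1 h2).trans ?_))
  rw [← ENNReal.ofReal_add (Real.exp_pos _).le (Real.exp_pos _).le, two_mul]

end MaximalInequality

/-! ### Truncation and the estimate on a single block -/

section Truncation

/-- The part of `x` that is cut off by truncation at level `T`. -/
noncomputable def tailPart (T x : ℝ) : ℝ := if |x| ≤ T then 0 else x

theorem measurable_tailPart (T : ℝ) : Measurable (tailPart T) :=
  Measurable.ite (measurableSet_le measurable_abs measurable_const) measurable_const measurable_id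

theorem abs_tailPart_le (T x : ℝ) : |tailPart T x| ≤ |x| := by
  unfold tailPart; split_ifs <;> simp

theorem abs_sub_tailPart_le {T : ℝ} (hT : 0 ≤ T) (x : ℝ) : |x - tailPart T x| ≤ T := by
  unfold tailPart; split_ifs with h <;> simpa

theorem sq_sub_tailPart_le (T x : ℝ) : (x - tailPart T x) ^ 2 ≤ x ^ 2 := by
  unfold tailPart; split_ifs <;> simp [sq_nonneg]

/-- Pointwise Markov inequality: the tail part is nonzero only where `T < |x|`. -/
theorem mul_abs_tailPart_le {T : ℝ} (hT : 0 ≤ T) (x : ℝ) :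
    T * |tailPart T x| ≤ {y : ℝ | T ^ 2 ≤ y ^ 2}.indicator (fun y => y ^ 2) x := by
  unfold tailPart
  split_ifs with h
  · simp only [abs_zero, mul_zero]
    exact Set.indicator_nonneg (fun _ _ => sq_nonneg _) _
  · have h' := (not_le.1 h).le
    rw [Set.indicator_of_mem (by
      rw [Set.mem_ofPred_eq, ← sq_abs x]; exact pow_le_pow_left₀ hT h' 2), ← sq_abs x, sq]
    exact mul_le_mul_of_nonneg_right h' (abs_nonneg _)

/-- If the levels `T` grow geometrically, then `∑ T i * |tailPart (T i) x|` is at most of order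
`x ^ 2`, and it vanishes when `x` is below all levels. -/
theorem sum_mul_abs_tailPart_le {T : ℕ → ℝ} {ρ : ℝ} (hρ : 1 < ρ) (hT0 : ∀ i, 0 ≤ T i)
    (hT : ∀ i, ρ * T i ≤ T (i + 1)) (x : ℝ) (n : ℕ) :
    ∑ i ∈ Finset.range n, T i * |tailPart (T i) x| ≤
      {y : ℝ | T 0 ^ 2 ≤ y ^ 2}.indicator (fun y => ρ / (ρ - 1) * y ^ 2) x := by
  have hρ1 : 0 < ρ - 1 := by linarith
  have hmono : Monotone T := monotone_nat_of_le_succ fun i => by nlinarith [hT i, hT0 i]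
  have hc : 0 ≤ ρ / (ρ - 1) := by positivity
  by_cases hx : |x| ≤ T 0
  · rw [Finset.sum_eq_zero fun i _ => by
      rw [tailPart, if_pos (hx.trans (hmono (Nat.zero_le i))), abs_zero, mul_zero]]
    exact Set.indicator_nonneg (fun _ _ => by positivity) _
  have hx' := (not_le.1 hx).le
  rw [Set.indicator_of_mem (by
    rw [Set.mem_ofPred_eq, ← sq_abs x]; exact pow_le_pow_left₀ (hT0 0) hx' 2)]
  -- Only levels below `|x|` contribute, and a geometric sum is at most `ρ / (ρ - 1)` times its
  -- largest term; that term is at most `T n / ρ` and at most `|x|`.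
  have key : ∀ n, ∑ i ∈ Finset.range n, T i * |tailPart (T i) x| ≤
      ρ / (ρ - 1) * min (T n / ρ) |x| * |x| := by
    intro n
    induction n with
    | zero =>
      simp only [Finset.range_zero, Finset.sum_empty]
      have := hT0 0
      positivity
    | succ n ih =>
      rw [Finset.sum_range_succ]
      have h1 : T n ≤ T (n + 1) / ρ := by
        rw [le_div_iff₀ (by linarith)]; linarith [hT n]
      by_cases h : |x| ≤ T n
      · rw [tailPart, if_pos h, abs_zero, mul_zero, add_zero]
        refine ih.trans ?_
        have : T n / ρ ≤ T (n + 1) / ρ := by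
          gcongr
          exact hmono (Nat.le_succ n)
        gcongr
      · rw [tailPart, if_neg h]
        have h2 : T n ≤ min (T (n + 1) / ρ) |x| := le_min h1 (not_le.1 h).le
        have h3 : ρ / (ρ - 1) * min (T n / ρ) |x| * |x| ≤ ρ / (ρ - 1) * (T n / ρ) * |x| := by
          gcongr
          exact min_le_left _ _
        have h4 : ρ / (ρ - 1) * (T n / ρ) * |x| + T n * |x| = ρ / (ρ - 1) * T n * |x| := by
          field_simp
          ring
        calc _ ≤ ρ / (ρ - 1) * T n * |x| := by linarith
          _ ≤ _ := by gcongr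
  refine (key n).trans ?_
  rw [mul_assoc, ← sq_abs x, sq]
  gcongr
  exact min_le_right _ _

variable {Ω : Type*} [MeasurableSpace Ω] {P : Measure Ω}

theorem ofReal_mul_lintegral_tailPart_le {Y : Ω → ℝ} (hY : Measurable Y) {T : ℝ} (hT : 0 ≤ T) :
    ENNReal.ofReal T * ∫⁻ ω, ENNReal.ofReal |tailPart T (Y ω)| ∂P ≤
      truncatedSecondMoment Y P (T ^ 2) := by
  rw [truncatedSecondMoment, ← lintegral_const_mul' _ _ ENNReal.ofReal_ne_top,
    ← lintegral_indicator (measurableSet_le measurable_const (hY.pow_const 2))]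
  refine lintegral_mono fun ω => ?_
  rw [← ENNReal.ofReal_mul hT]
  refine (ENNReal.ofReal_le_ofReal (mul_abs_tailPart_le hT (Y ω))).trans (le_of_eq ?_)
  simp only [Set.indicator_apply, Set.mem_ofPred_eq]
  split_ifs <;> simp

/-- Tonelli reduces this to the pointwise geometric sum, so all blocks together cost no more than
one truncated second moment. -/
theorem tsum_mul_lintegral_tailPart_le {Y : Ω → ℝ} (hY : Measurable Y) {T : ℕ → ℝ} {ρ : ℝ}
    (hρ : 1 < ρ) (hT0 : ∀ i, 0 ≤ T i) (hT : ∀ i, ρ * T i ≤ T (i + 1)) :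
    ∑' i, ENNReal.ofReal (T i) * ∫⁻ ω, ENNReal.ofReal |tailPart (T i) (Y ω)| ∂P ≤
      ENNReal.ofReal (ρ / (ρ - 1)) * truncatedSecondMoment Y P (T 0 ^ 2) := by
  have hρ1 : 0 < ρ - 1 := by linarith
  have hm : ∀ i, Measurable fun ω => ENNReal.ofReal |tailPart (T i) (Y ω)| := fun i =>
    (((measurable_tailPart (T i)).comp hY).abs).ennreal_ofReal
  simp_rw [← lintegral_const_mul' _ _ ENNReal.ofReal_ne_top]
  rw [truncatedSecondMoment, ← lintegral_tsum fun i => ((hm i).const_mul _).aemeasurable,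
    ← lintegral_indicator (measurableSet_le measurable_const (hY.pow_const 2)),
    ← lintegral_const_mul' _ _ ENNReal.ofReal_ne_top]
  refine lintegral_mono fun ω => ?_
  refine ENNReal.tsum_le_of_sum_range_le fun n => ?_
  simp_rw [← ENNReal.ofReal_mul (hT0 _)]
  rw [← ENNReal.ofReal_sum_of_nonneg fun i _ => mul_nonneg (hT0 i) (abs_nonneg _)]
  refine (ENNReal.ofReal_le_ofReal (sum_mul_abs_tailPart_le hρ hT0 hT (Y ω) n)).trans
    (le_of_eq ?_)
  simp only [Set.indicator_apply, Set.mem_ofPred_eq]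
  split_ifs
  · rw [ENNReal.ofReal_mul (by positivity)]
  · simp

/-- The law of the iterated logarithm on one block: a maximal inequality for i.i.d. variables whose
second moment beyond the truncation level `T` is small. -/
theorem measure_block_le {Y : ℕ → Ω → ℝ} (hY : ∀ i, Measurable (Y i)) (hind : iIndepFun Y P)
    (hid : ∀ i, IdentDistrib (Y i) (Y 0) P P) (hL2 : MemLp (Y 0) 2 P)
    (hmean : ∫ ω, Y 0 ω ∂P = 0) (hvar : ∫ ω, Y 0 ω ^ 2 ∂P ≤ 1) {A s δ T : ℝ} (hA : 0 < A)
    (hs : 0 < s) (hδ : 0 < δ) (hδ1 : δ ≤ 1) (hT : T * s = δ / 50 * A) {N : ℕ}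
    (hN : N ≤ (1 + δ / 8) * A)
    (htail : truncatedSecondMoment (Y 0) P (T ^ 2) ≤
      ENNReal.ofReal (δ / 50 * δ / (4 * (1 + δ / 8)))) :
    P {ω | ∃ k ≤ N, (1 + δ) * (√2 * s) ≤ |∑ i ∈ Finset.range k, Y i ω|} ≤
      ENNReal.ofReal (2 * Real.exp (-((1 + δ / 4) * (s ^ 2 / A)))) +
      ENNReal.ofReal (4 * (1 + δ / 8) / (δ * (δ / 50))) *
        (ENNReal.ofReal T * ∫⁻ ω, ENNReal.ofReal |tailPart T (Y 0 ω)| ∂P) := by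
  have : IsProbabilityMeasure P := hind.isProbabilityMeasure
  set a := 1 + δ / 8 with ha
  have ha0 : 0 < a := by positivity
  have hTs : 0 < T * s := by rw [hT]; positivity
  have hT0 : 0 < T := pos_of_mul_pos_left hTs hs.le
  have hsqrt1 : 1 ≤ √2 := by rw [Real.one_le_sqrt]; norm_num
  have hsqrt2 : √2 ≤ 3 / 2 := by rw [Real.sqrt_le_left (by norm_num)]; norm_num
  have hYi : Integrable (Y 0) P := hL2.integrable (by norm_num)
  set W : ℕ → Ω → ℝ := fun i ω => tailPart T (Y i ω) with hW
  have hWm : ∀ i, Measurable (W i) := fun i => (measurable_tailPart T).comp (hY i)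
  have hWi : Integrable (W 0) P :=
    hYi.mono (hWm 0).aestronglyMeasurable (ae_of_all _ fun ω => abs_tailPart_le T _)
  set V : ℕ → Ω → ℝ := fun i ω => Y i ω - W i ω with hV
  have hVm : ∀ i, Measurable (V i) := fun i => (hY i).sub (hWm i)
  set m := ∫ ω, V 0 ω ∂P with hm
  set I := ∫ ω, |W 0 ω| ∂P with hI
  have hI0 : 0 ≤ I := integral_nonneg fun ω => abs_nonneg _
  have hmI : |m| ≤ I := by
    have : m = -∫ ω, W 0 ω ∂P := by
      rw [hm, hV, integral_sub hYi hWi, hmean, zero_sub]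
    rw [this, abs_neg]
    exact abs_integral_le_integral_abs
  have hTI : T * I ≤ δ / 50 * δ / (4 * a) := by
    have h1 := (ofReal_mul_lintegral_tailPart_le (P := P) (hY 0) hT0.le).trans htail
    rw [← ofReal_integral_eq_lintegral_ofReal hWi.abs (ae_of_all _ fun ω => abs_nonneg _),
      ← ENNReal.ofReal_mul hT0.le] at h1
    exact (ENNReal.ofReal_le_ofReal_iff (by positivity)).1 h1
  -- Since `Y 0` is centred, `|m|` is at most the mean of the discarded part; the drift it causes
  -- over the block uses only `δ/4` of the boundary.
  have hNm : N * |m| ≤ δ / 4 * s := by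
    have h1 : (N : ℝ) * |m| ≤ a * A * I := mul_le_mul hN hmI (abs_nonneg _) (by positivity)
    have h2 : δ / 50 * (a * A * I) = a * s * (T * I) := by
      linear_combination (-a * I) * hT
    have h3 : a * s * (T * I) ≤ a * s * (δ / 50 * δ / (4 * a)) := by gcongr
    have h4 : a * s * (δ / 50 * δ / (4 * a)) = δ / 50 * (δ / 4 * s) := by field_simp
    have h5 : a * A * I ≤ δ / 4 * s :=
      le_of_mul_le_mul_left (by linarith) (show 0 < δ / 50 by positivity)
    linarith
  set Z : ℕ → Ω → ℝ := fun i ω => V i ω - m with hZ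
  have hZm : ∀ i, Measurable (Z i) := fun i => (hVm i).sub_const m
  have hVT : ∀ i ω, |V i ω| ≤ T := fun i ω => abs_sub_tailPart_le hT0.le _
  have hVi : ∀ i, Integrable (V i) P := fun i => integrable_of_abs_le (hVm i) (hVT i)
  have hmT : |m| ≤ T := by
    have := norm_integral_le_of_norm_le_const (μ := P) (f := V 0) (C := T) (ae_of_all _ (hVT 0))
    simpa using this
  have hZT : ∀ i ω, |Z i ω| ≤ 2 * T := fun i ω =>
    (abs_sub _ _).trans (by linarith [hVT i ω])
  have hfun : Measurable fun x => x - tailPart T x := measurable_id.sub (measurable_tailPart T)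
  have hVid : ∀ i, IdentDistrib (V i) (V 0) P P := fun i => (hid i).comp hfun
  have hZind : iIndepFun Z P :=
    hind.comp (fun _ x => x - tailPart T x - m) fun _ => hfun.sub_const m
  have hZmean : ∀ i, ∫ ω, Z i ω ∂P = 0 := fun i => by
    rw [hZ, integral_sub (hVi i) (integrable_const _), (hVid i).integral_eq]
    simp [hm]
  have hZvar : ∀ i, ∫ ω, Z i ω ^ 2 ∂P ≤ 1 := fun i => by
    have h1 : ∫ ω, Z i ω ^ 2 ∂P = variance (V i) P := by
      rw [variance_eq_integral (hVm i).aemeasurable, (hVid i).integral_eq]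
    rw [h1, (hVid i).variance_eq]
    refine (variance_le_expectation_sq (hVm 0).aestronglyMeasurable).trans (le_trans ?_ hvar)
    exact integral_mono_of_nonneg (ae_of_all _ fun ω => sq_nonneg _) hL2.integrable_sq
      (ae_of_all _ fun ω => sq_sub_tailPart_le T _)
  set l := (1 + δ / 2) * (√2 * s) with hl
  have hl0 : 0 < l := by positivity
  have hE1 : P {ω | ∃ k ≤ N, l ≤ |∑ i ∈ Finset.range k, Z i ω|} ≤
      ENNReal.ofReal (2 * Real.exp (-((1 + δ / 4) * (s ^ 2 / A)))) := by
    -- `θ = l / (a * A)` minimises `-θ l + a A θ² / 2`. With `T s = δ A / 50` it gives `θ * 2T ≤ δ /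
    -- 10`, whence `c`.
    refine (measure_exists_abs_sum_ge_le hZm hZind (c := δ / 10) (θ := l / (a * A)) hZT hZmean
      hZvar (by positivity) hl0 ?_ (by linarith) N).trans (ENNReal.ofReal_le_ofReal ?_)
    · rw [div_mul_eq_mul_div, div_le_iff₀ (by positivity)]
      have h1 : l * (2 * T) = 2 * (1 + δ / 2) * √2 * (δ / 50 * A) := by
        rw [← hT, hl]; ring
      rw [h1]
      have h2 : 2 * (1 + δ / 2) * √2 ≤ 2 * (3 / 2) * (3 / 2) := by gcongr; linarith
      have h3 : 2 * (1 + δ / 2) * √2 * (δ / 50 * A) ≤ 2 * (3 / 2) * (3 / 2) * (δ / 50 * A) := by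
        gcongr
      have h4 : δ * A ≤ δ * A * a := le_mul_of_one_le_right (by positivity) (by linarith)
      linarith
    · have hll : l ^ 2 = (1 + δ / 2) ^ 2 * 2 * s ^ 2 := by
        rw [hl, mul_pow, mul_pow, Real.sq_sqrt (by norm_num)]; ring
      have h1 : (N : ℝ) * ((l / (a * A)) ^ 2 * 1 / 2 * (1 + δ / 10)) ≤
          a * A * ((l / (a * A)) ^ 2 * 1 / 2 * (1 + δ / 10)) := by gcongr
      have h2 : -(l / (a * A) * l) + a * A * ((l / (a * A)) ^ 2 * 1 / 2 * (1 + δ / 10)) =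
          -((1 + δ / 2) ^ 2 * (1 - δ / 10) / a * (s ^ 2 / A)) := by
        have : -(l / (a * A) * l) + a * A * ((l / (a * A)) ^ 2 * 1 / 2 * (1 + δ / 10)) =
          -(l ^ 2 / (a * A) * ((1 - δ / 10) / 2)) := by field_simp; ring
        rw [this, hll]; field_simp
      -- The gain `(1 + δ/2)²` outweighs both the block ratio `a` and the Bernstein correction,
      -- leaving an exponent above 1.
      have h3 : 1 + δ / 4 ≤ (1 + δ / 2) ^ 2 * (1 - δ / 10) / a := by
        rw [le_div_iff₀ ha0, ha]
        nlinarith [mul_nonneg hδ.le (sub_nonneg.2 hδ1),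
          mul_nonneg (sq_nonneg δ) (sub_nonneg.2 hδ1)]
      have h4 : (1 + δ / 4) * (s ^ 2 / A) ≤ (1 + δ / 2) ^ 2 * (1 - δ / 10) / a * (s ^ 2 / A) := by
        gcongr
      gcongr
      linarith
  -- Markov for the whole block: `N ≤ a A` and `A = 50 T s / δ` turn `N E|W| / (δ s / 4)` into a
  -- multiple of `T E|W|`.
  have hE2 : P {ω | ENNReal.ofReal (δ / 4 * s) ≤
      ∑ i ∈ Finset.range N, ENNReal.ofReal |W i ω|} ≤
      ENNReal.ofReal (4 * a / (δ * (δ / 50))) *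
        (ENNReal.ofReal T * ∫⁻ ω, ENNReal.ofReal |tailPart T (Y 0 ω)| ∂P) := by
    have hm' : ∀ i, Measurable fun ω => ENNReal.ofReal |W i ω| := fun i =>
      (hWm i).abs.ennreal_ofReal
    refine (meas_ge_le_lintegral_div
      (Finset.measurable_sum (Finset.range N) fun i _ => hm' i).aemeasurable
      (by simpa using by positivity) ENNReal.ofReal_ne_top).trans ?_
    rw [lintegral_finsetSum _ fun i _ => hm' i]
    have h1 : ∀ i, ∫⁻ ω, ENNReal.ofReal |W i ω| ∂P =
        ∫⁻ ω, ENNReal.ofReal |tailPart T (Y 0 ω)| ∂P := fun i =>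
      ((hid i).comp (measurable_tailPart T).abs.ennreal_ofReal).lintegral_eq
    simp_rw [h1]
    rw [Finset.sum_const, Finset.card_range, nsmul_eq_mul, ENNReal.div_eq_inv_mul, ← mul_assoc,
      ← mul_assoc, mul_comm _ (N : ℝ≥0∞), ← div_eq_mul_inv]
    refine mul_le_mul' ?_ le_rfl
    rw [← ENNReal.ofReal_natCast, ← ENNReal.ofReal_div_of_pos (by positivity),
      ← ENNReal.ofReal_mul (by positivity)]
    refine ENNReal.ofReal_le_ofReal ?_
    rw [div_le_iff₀ (by positivity)]
    have : 4 * a / (δ * (δ / 50)) * T * (δ / 4 * s) = a * A := by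
      calc _ = 4 * a / (δ * (δ / 50)) * (δ / 4) * (T * s) := by ring
        _ = a * A := by rw [hT]; field_simp
    rw [this]
    exact hN
  -- Budget: `l` for the centred truncated sum, `δ s / 4` each for the tails and the drift; the
  -- total stays below the boundary because `√2 ≥ 1`.
  refine le_trans (measure_mono ?_) ((measure_union_le _ _).trans (add_le_add hE1 hE2))
  rintro ω ⟨k, hk, hkω⟩
  by_contra hcon
  rw [Set.mem_union, not_or] at hcon
  obtain ⟨hc1, hc2⟩ := hcon
  have hc1' : |∑ i ∈ Finset.range k, Z i ω| < l := by
    by_contra h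
    exact hc1 ⟨k, hk, not_lt.1 h⟩
  have hc2' : ∑ i ∈ Finset.range N, |W i ω| < δ / 4 * s := by
    rw [Set.mem_ofPred_eq, not_le,
      ← ENNReal.ofReal_sum_of_nonneg fun i _ => abs_nonneg _] at hc2
    exact (ENNReal.ofReal_lt_ofReal_iff (by positivity)).1 hc2
  have hW' : |∑ i ∈ Finset.range k, W i ω| ≤ ∑ i ∈ Finset.range N, |W i ω| :=
    (Finset.abs_sum_le_sum_abs _ _).trans (Finset.sum_le_sum_of_subset_of_nonneg
      (Finset.range_mono hk) fun i _ _ => abs_nonneg _)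
  have hdec : ∑ i ∈ Finset.range k, Y i ω =
      ∑ i ∈ Finset.range k, Z i ω + ∑ i ∈ Finset.range k, W i ω + k * m := by
    have : (k : ℝ) * m = ∑ i ∈ Finset.range k, m := by simp
    rw [this, ← Finset.sum_add_distrib, ← Finset.sum_add_distrib]
    exact Finset.sum_congr rfl fun i _ => by simp only [hZ, hV]; ring
  have hkm : |(k : ℝ) * m| ≤ N * |m| := by
    rw [abs_mul, Nat.abs_cast]
    gcongr
  have h1 := abs_add_three (∑ i ∈ Finset.range k, Z i ω) (∑ i ∈ Finset.range k, W i ω) (k * m)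
  rw [hdec] at hkω
  have h2 : s ≤ √2 * s := le_mul_of_one_le_left hs.le hsqrt1
  have h3 : δ * s ≤ δ * (√2 * s) := by gcongr
  have h4 : (1 + δ) * (√2 * s) = l + δ / 2 * (√2 * s) := by rw [hl]; ring
  linarith

end Truncation

/-! ### Growth of the iterated logarithm and of the truncation levels along blocks -/

section Blocks

theorem tendsto_log_log_pow {a : ℝ} (ha : 1 < a) :
    Tendsto (fun j : ℕ => Real.log (Real.log (a ^ j))) atTop atTop :=
  Real.tendsto_log_atTop.comp (Real.tendsto_log_atTop.comp (tendsto_pow_atTop_atTop_of_one_lt ha))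

/-- One step at most doubles `log (a ^ j)`, so the iterated logarithm grows by at most `log 2`. -/
theorem eventually_log_log_pow_succ_le {a ρ : ℝ} (ha : 1 < a) (hρ : 1 < ρ) :
    ∀ᶠ j : ℕ in atTop, Real.log (Real.log (a ^ (j + 1))) ≤ ρ * Real.log (Real.log (a ^ j)) := by
  have h1 := (tendsto_log_log_pow ha).eventually_ge_atTop (Real.log 2 / (ρ - 1))
  filter_upwards [h1, eventually_ge_atTop 1] with j hj hj1
  have hla := Real.log_pos ha
  have hj1' : (1 : ℝ) ≤ j := by exact_mod_cast hj1
  rw [div_le_iff₀ (by linarith)] at hj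
  have h2 : Real.log (a ^ (j + 1)) ≤ 2 * Real.log (a ^ j) := by
    rw [Real.log_pow, Real.log_pow]; push_cast; nlinarith
  have h3 : 0 < Real.log (a ^ j) := by rw [Real.log_pow]; positivity
  have h4 : 0 < Real.log (a ^ (j + 1)) := by rw [Real.log_pow]; positivity
  have h5 := Real.log_le_log h4 h2
  rw [Real.log_mul (by norm_num) h3.ne'] at h5
  linarith

theorem summable_exp_neg_mul_log_log_pow {a p : ℝ} (ha : 1 < a) (hp : 1 < p) :
    Summable fun j : ℕ => 2 * Real.exp (-(p * Real.log (Real.log (a ^ j)))) := by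
  have hla := Real.log_pos ha
  have h1 : Summable fun j : ℕ => 2 * Real.log a ^ (-p) * (j : ℝ) ^ (-p) :=
    (Real.summable_nat_rpow.2 (by linarith)).mul_left _
  refine h1.of_norm_bounded_eventually_nat ?_
  filter_upwards [eventually_ge_atTop 1] with j hj
  have hj1 : (0 : ℝ) < j := by exact_mod_cast hj
  rw [Real.norm_of_nonneg (by positivity), Real.log_pow, mul_assoc,
    ← Real.mul_rpow hla.le hj1.le, mul_comm (Real.log a), Real.rpow_def_of_pos (by positivity)]
  refine le_of_eq ?_
  ring_nf

/-- The truncation level `δ / 50 * √(A / log log A)` for `A = a ^ j`. -/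
noncomputable def truncationLevel (a δ : ℝ) (j : ℕ) : ℝ :=
  δ / 50 * a ^ j / √(a ^ j * Real.log (Real.log (a ^ j)))

theorem truncationLevel_nonneg {a δ : ℝ} (ha : 1 < a) (hδ : 0 < δ) (j : ℕ) :
    0 ≤ truncationLevel a δ j := by
  unfold truncationLevel; positivity

/-- The squared ratio of consecutive levels is `a` times a ratio of iterated logarithms that is at
least `1 / ρ`, hence at least `a / ρ ≥ ρ²`. -/
theorem eventually_mul_truncationLevel_le {a δ ρ : ℝ} (ha : 1 < a) (hδ : 0 < δ) (hρ : 1 < ρ)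
    (hρa : ρ ^ 3 ≤ a) :
    ∀ᶠ j : ℕ in atTop, ρ * truncationLevel a δ j ≤ truncationLevel a δ (j + 1) := by
  filter_upwards [(tendsto_log_log_pow ha).eventually_gt_atTop 0,
    ((tendsto_log_log_pow ha).comp (tendsto_add_atTop_nat 1)).eventually_gt_atTop 0,
    eventually_log_log_pow_succ_le ha hρ] with j h1 h2 h3
  simp only [Function.comp] at h2
  have ha0 : 0 < a := by linarith
  unfold truncationLevel
  set l := Real.log (Real.log (a ^ j))
  set l' := Real.log (Real.log (a ^ (j + 1)))
  have hA : 0 < a ^ j := by positivity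
  have hs : 0 < √(a ^ j * l) := Real.sqrt_pos.2 (by positivity)
  have hs' : 0 < √(a ^ (j + 1) * l') := Real.sqrt_pos.2 (by positivity)
  have key : ρ * √(a ^ (j + 1) * l') ≤ a * √(a ^ j * l) := by
    refine le_of_sq_le_sq ?_ (by positivity)
    rw [mul_pow, mul_pow, Real.sq_sqrt (by positivity), Real.sq_sqrt (by positivity), pow_succ a j]
    calc ρ ^ 2 * (a ^ j * a * l') ≤ ρ ^ 2 * (a ^ j * a * (ρ * l)) := by gcongr
      _ = ρ ^ 3 * (a ^ j * a * l) := by ring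
      _ ≤ a * (a ^ j * a * l) := by gcongr
      _ = _ := by ring
  rw [← mul_div_assoc, div_le_div_iff₀ hs hs', pow_succ a j]
  rw [pow_succ a j] at key
  calc ρ * (δ / 50 * a ^ j) * √(a ^ j * a * l') = δ / 50 * a ^ j * (ρ * √(a ^ j * a * l')) := by ring
    _ ≤ δ / 50 * a ^ j * (a * √(a ^ j * l)) := by gcongr
    _ = _ := by ring

theorem tendsto_truncationLevel {a δ ρ : ℝ} (ha : 1 < a) (hδ : 0 < δ) (hρ : 1 < ρ)
    (hρa : ρ ^ 3 ≤ a) : Tendsto (truncationLevel a δ) atTop atTop := by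
  obtain ⟨J, hJ⟩ := eventually_atTop.1 ((eventually_mul_truncationLevel_le ha hδ hρ hρa).and
    ((tendsto_log_log_pow ha).eventually_gt_atTop 0))
  rw [← tendsto_add_atTop_iff_nat J]
  refine tendsto_atTop_of_geom_le ?_ hρ fun n => ?_
  · have := (hJ J le_rfl).2
    have ha0 : 0 < a := by linarith
    simp only [truncationLevel, zero_add]
    positivity
  · have := (hJ (n + J) (Nat.le_add_left _ _)).1
    rwa [show n + 1 + J = n + J + 1 by ring]

end Blocks

/-! ### Union over blocks, uniformly in the law -/

section UniformLIL

variable {Ω : Type*} [MeasurableSpace Ω]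

/-- The upper bound of the law of the iterated logarithm, uniform over a family of laws, for i.i.d.
variables `Y P` of second moment at most one. -/
theorem tendsto_iSup_measure_exists_sum_ge {Laws : Set (Measure Ω)} {Y : Measure Ω → ℕ → Ω → ℝ}
    (hY : ∀ P ∈ Laws, ∀ i, Measurable (Y P i)) (hind : ∀ P ∈ Laws, iIndepFun (Y P) P)
    (hid : ∀ P ∈ Laws, ∀ i, IdentDistrib (Y P i) (Y P 0) P P)
    (hL2 : ∀ P ∈ Laws, MemLp (Y P 0) 2 P) (hmean : ∀ P ∈ Laws, ∫ ω, Y P 0 ω ∂P = 0)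
    (hvar : ∀ P ∈ Laws, ∫ ω, Y P 0 ω ^ 2 ∂P ≤ 1)
    (hUI : HasUniformlyIntegrableSecondMoment Laws fun P => Y P 0) {δ : ℝ} (hδ : 0 < δ)
    (hδ1 : δ ≤ 1) :
    Tendsto (fun m : ℕ => ⨆ P ∈ Laws, P {ω | ∃ k, m ≤ k ∧
      (1 + δ) * √(2 * k * Real.log (Real.log k)) ≤ |∑ i ∈ Finset.range k, Y P i ω|})
      atTop (𝓝 0) := by
  set a := 1 + δ / 8 with ha
  set ρ := 1 + δ / 32 with hρ
  have ha1 : 1 < a := by rw [ha]; linarith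
  have ha0 : 0 < a := by linarith
  have hρ1 : 1 < ρ := by rw [hρ]; linarith
  have hρa : ρ ^ 3 ≤ a := by
    rw [hρ, ha]
    nlinarith [mul_nonneg hδ.le (sub_nonneg.2 hδ1), mul_nonneg (sq_nonneg δ) (sub_nonneg.2 hδ1)]
  set T := truncationLevel a δ with hT
  set u : ℝ → ℝ≥0∞ := fun x => ⨆ P ∈ Laws, truncatedSecondMoment (Y P 0) P x with hu
  have huT : Tendsto (fun j => u (T j ^ 2)) atTop (𝓝 0) :=
    hUI.comp ((tendsto_pow_atTop two_ne_zero).comp (tendsto_truncationLevel ha1 hδ hρ1 hρa))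
  set E : ℕ → ℝ≥0∞ := fun j =>
    ENNReal.ofReal (2 * Real.exp (-((1 + δ / 4) * Real.log (Real.log (a ^ j))))) with hE
  have hEsum : ∑' j, E j ≠ ∞ :=
    (summable_exp_neg_mul_log_log_pow ha1 (by linarith)).tsum_ofReal_ne_top
  set C := ENNReal.ofReal (4 * a / (δ * (δ / 50))) * ENNReal.ofReal (ρ / (ρ - 1)) with hC
  -- This bound does not depend on `P`: a tail of a fixed convergent series plus the supremum of the
  -- truncated second moments.
  have hbound : Tendsto (fun J => ∑' i, E (i + J) + C * u (T J ^ 2)) atTop (𝓝 0) := by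
    have h1 := ENNReal.tendsto_sum_nat_add E hEsum
    have h2 := ENNReal.Tendsto.const_mul (a := C) huT
      (Or.inr (ENNReal.mul_ne_top ENNReal.ofReal_ne_top ENNReal.ofReal_ne_top))
    simpa using h1.add h2
  obtain ⟨J₀, hJ₀⟩ := eventually_atTop.1 ((eventually_mul_truncationLevel_le ha1 hδ hρ1 hρa).and
    (((tendsto_log_log_pow ha1).eventually_gt_atTop 0).and
    ((eventually_ge_atTop 1).and (ENNReal.tendsto_nhds_zero.1 huT
      (ENNReal.ofReal (δ / 50 * δ / (4 * a))) (by simpa using by positivity)))))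
  rw [ENNReal.tendsto_nhds_zero]
  intro η hη
  obtain ⟨J, hJη, hJ⟩ :=
    ((ENNReal.tendsto_nhds_zero.1 hbound η hη).and (eventually_ge_atTop J₀)).exists
  filter_upwards [eventually_ge_atTop ⌈a ^ J⌉₊] with m hm
  refine iSup₂_le fun P hP => le_trans ?_ hJη
  have hPu : ∀ x, truncatedSecondMoment (Y P 0) P x ≤ u x := fun x =>
    le_iSup₂ (f := fun P (_ : P ∈ Laws) => truncatedSecondMoment (Y P 0) P x) P hP
  set s : ℕ → ℝ := fun j => √(a ^ j * Real.log (Real.log (a ^ j))) with hs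
  set B : ℕ → Set Ω := fun j => {ω | ∃ k ≤ ⌊a ^ (j + 1)⌋₊,
    (1 + δ) * (√2 * s j) ≤ |∑ i ∈ Finset.range k, Y P i ω|} with hB
  have hsub : {ω | ∃ k, m ≤ k ∧ (1 + δ) * √(2 * k * Real.log (Real.log k)) ≤
      |∑ i ∈ Finset.range k, Y P i ω|} ⊆ ⋃ i, B (i + J) := by
    rintro ω ⟨k, hk, hkω⟩
    have hJk : a ^ J ≤ k := Nat.ceil_le.1 (hm.trans hk)
    obtain ⟨j, hj1, hj2⟩ := exists_nat_pow_near ((one_le_pow₀ ha1.le).trans hJk) ha1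
    have hJj : J ≤ j := by
      have := (pow_lt_pow_iff_right₀ ha1).1 (hJk.trans_lt hj2)
      omega
    refine Set.mem_iUnion.2 ⟨j - J, ?_⟩
    rw [Nat.sub_add_cancel hJj]
    refine ⟨k, Nat.le_floor hj2.le, le_trans ?_ hkω⟩
    obtain ⟨-, hl, hj0, -⟩ := hJ₀ j (hJ.trans hJj)
    rw [hs, ← Real.sqrt_mul (by norm_num), ← mul_assoc]
    have hlog : 0 < Real.log (a ^ j) :=
      Real.log_pos (one_lt_pow₀ ha1 (by omega))
    have hlog' := Real.log_le_log (by positivity) hj1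
    have hloglog := Real.log_le_log hlog hlog'
    gcongr
  refine (measure_mono hsub).trans ((measure_iUnion_le _).trans ?_)
  have hblock : ∀ i, P (B (i + J)) ≤ E (i + J) + ENNReal.ofReal (4 * a / (δ * (δ / 50))) *
      (ENNReal.ofReal (T (i + J)) *
        ∫⁻ ω, ENNReal.ofReal |tailPart (T (i + J)) (Y P 0 ω)| ∂P) := by
    intro i
    obtain ⟨-, hl, hj0, hκ⟩ := hJ₀ (i + J) (by omega)
    have hA : 0 < a ^ (i + J) := by positivity
    have hs0 : 0 < s (i + J) := Real.sqrt_pos.2 (by positivity)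
    have h := measure_block_le (T := T (i + J)) (N := ⌊a ^ (i + J + 1)⌋₊) (hY P hP) (hind P hP)
      (hid P hP) (hL2 P hP) (hmean P hP) (hvar P hP) hA hs0 hδ hδ1
      (div_mul_cancel₀ _ hs0.ne')
      ((Nat.floor_le (by positivity)).trans (by rw [pow_succ, mul_comm]))
      ((hPu _).trans hκ)
    have hsq : s (i + J) ^ 2 / a ^ (i + J) = Real.log (Real.log (a ^ (i + J))) := by
      rw [hs, Real.sq_sqrt (by positivity)]
      field_simp
    rwa [hsq] at h
  refine (ENNReal.tsum_le_tsum hblock).trans ?_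
  rw [ENNReal.tsum_add, ENNReal.tsum_mul_left]
  have hsum := tsum_mul_lintegral_tailPart_le (P := P) (hY P hP 0) (T := fun i => T (i + J)) hρ1
    (fun i => truncationLevel_nonneg ha1 hδ _) (fun i => by
      have := (hJ₀ (i + J) (by omega)).1
      rwa [show i + 1 + J = i + J + 1 by ring])
  simp only [zero_add] at hsum
  rw [hC, mul_assoc]
  gcongr
  exact hsum.trans (by gcongr; exact hPu _)

end UniformLIL

/-! ### Lower bound for the empirical second moment -/

section SampleVariance

/-- The boundary is `o(k)`; below it the sample mean is therefore negligible. -/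
theorem eventually_mul_sqrt_log_log_le {c : ℝ} (hc : 0 < c) (b : ℝ) :
    ∀ᶠ k : ℕ in atTop, b * √(2 * k * Real.log (Real.log k)) ≤ c * k := by
  have h1 : Tendsto (fun x : ℝ => Real.log x / x) atTop (𝓝 0) := by
    simpa using Real.tendsto_pow_log_div_mul_add_atTop 1 0 1 one_ne_zero
  have h2 : Tendsto (fun k : ℕ => 2 * (b ^ 2) * (Real.log k / k)) atTop (𝓝 0) := by
    simpa using (h1.comp tendsto_natCast_atTop_atTop).const_mul (2 * b ^ 2)
  filter_upwards [h2.eventually_le_const (show 0 < c ^ 2 by positivity), eventually_ge_atTop 3]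
    with k hk hk3
  have hk0 : (0 : ℝ) < k := by positivity
  have hlog : 0 ≤ Real.log k := Real.log_natCast_nonneg k
  have hll : Real.log (Real.log k) ≤ Real.log k := Real.log_le_self hlog
  refine (le_abs_self _).trans (abs_le_of_sq_le_sq ?_ (by positivity))
  rw [mul_pow, Real.sq_sqrt']
  have h3 : 2 * b ^ 2 * Real.log k ≤ c ^ 2 * k := by
    rw [← mul_div_assoc, div_le_iff₀ hk0] at hk
    exact hk
  have h4 : max (2 * k * Real.log (Real.log k)) 0 ≤ 2 * k * Real.log k :=
    max_le (by gcongr) (by positivity)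
  calc b ^ 2 * max (2 * k * Real.log (Real.log k)) 0 ≤ b ^ 2 * (2 * k * Real.log k) := by gcongr
    _ = (2 * b ^ 2 * Real.log k) * k := by ring
    _ ≤ c ^ 2 * k * k := by gcongr
    _ = (c * k) ^ 2 := by ring

variable {Ω : Type*}

theorem sampleVariance_eq (X : ℕ → Ω → ℝ) {k : ℕ} (hk : k ≠ 0) (ω : Ω) :
    sampleVariance X k ω =
      (∑ i ∈ Finset.range k, X i ω ^ 2) / k - ((∑ i ∈ Finset.range k, X i ω) / k) ^ 2 := by
  have hk' : (k : ℝ) ≠ 0 := by exact_mod_cast hk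
  simp only [sampleVariance, sub_sq, Finset.sum_add_distrib, Finset.sum_sub_distrib]
  rw [← Finset.sum_mul, ← Finset.mul_sum]
  simp only [sampleMean, Finset.sum_const, Finset.card_range, nsmul_eq_mul]
  field_simp
  ring

/-- The supremum need not be attained, so half of `δ` is given up to obtain an actual index. -/
theorem exists_of_mem_lilExceedance {X : ℕ → Ω → ℝ} {s : ℕ → Ω → ℝ} {δ : ℝ} (hδ : 0 < δ) {m : ℕ}
    {ω : Ω} (h : ω ∈ lilExceedance X s δ m) :
    ∃ k, m ≤ k ∧ ENNReal.ofReal (1 + δ / 2) < ENNReal.ofReal |partialSum X k ω| /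
      ENNReal.ofReal (s k ω) / ENNReal.ofReal √(2 * k * Real.log (Real.log k)) := by
  have h1 : ENNReal.ofReal (1 + δ / 2) < ENNReal.ofReal (1 + δ) :=
    (ENNReal.ofReal_lt_ofReal_iff (by linarith)).2 (by linarith)
  obtain ⟨k, hk⟩ := lt_iSup_iff.1 (h1.trans_le h)
  obtain ⟨hmk, hk⟩ := lt_iSup_iff.1 hk
  exact ⟨k, hmk, hk⟩

theorem mul_lt_abs_of_ofReal_lt_div {x s r b : ℝ} (hs : 0 < s) (hr : 0 < r)
    (h : ENNReal.ofReal b < ENNReal.ofReal |x| / ENNReal.ofReal s / ENNReal.ofReal r) :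
    b * r * s < |x| := by
  rw [← ENNReal.ofReal_div_of_pos hs, ← ENNReal.ofReal_div_of_pos hr] at h
  have h := (ENNReal.ofReal_lt_ofReal_iff').1 h
  have h := h.1
  rwa [lt_div_iff₀ hr, lt_div_iff₀ hs] at h

variable [MeasurableSpace Ω] {P : Measure Ω}

/-- The empirical second moment is bounded below with exponentially high probability. -/
theorem measure_exists_sum_min_sq_le {Y : ℕ → Ω → ℝ} (hY : ∀ i, Measurable (Y i))
    (hind : iIndepFun Y P) (hid : ∀ i, IdentDistrib (Y i) (Y 0) P P) (hL2 : MemLp (Y 0) 2 P)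
    (hvar : 1 ≤ ∫ ω, Y 0 ω ^ 2 ∂P) {b γ : ℝ} (hb : 0 < b) (hγ : 0 < γ)
    (htail : truncatedSecondMoment (Y 0) P b ≤ ENNReal.ofReal (γ / 4)) (m : ℕ) :
    P {ω | ∃ k, m ≤ k ∧ ∑ i ∈ Finset.range k, min (Y i ω ^ 2) b ≤ (1 - γ / 2) * k} ≤
      ∑' i : ℕ, ENNReal.ofReal (Real.exp (-(γ ^ 2 / (8 * b ^ 2))) ^ (i + m)) := by
  have : IsProbabilityMeasure P := hind.isProbabilityMeasure
  -- The sign turns the lower deviation into an upper one. Capping at `b` makes Hoeffding applicable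
  -- and costs at most `γ/4` in mean; the other `γ/4` is the deviation.
  set f : ℝ → ℝ := fun x => -min (x ^ 2) b with hf
  have hfm : Measurable f := ((measurable_id.pow_const 2).min measurable_const).neg
  set e := ∫ ω, f (Y 0 ω) ∂P with he
  have hfb : ∀ x, f x ∈ Set.Icc (-b) 0 := fun x =>
    ⟨neg_le_neg (min_le_right _ _), neg_nonpos.2 (le_min (sq_nonneg x) hb.le)⟩
  have hfi : Integrable (fun ω => f (Y 0 ω)) P :=
    Integrable.of_mem_Icc _ _ (hfm.comp (hY 0)).aemeasurable (ae_of_all _ fun ω => hfb _)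
  have hset : MeasurableSet {ω | b ≤ Y 0 ω ^ 2} :=
    measurableSet_le measurable_const ((hY 0).pow_const 2)
  have htail' : ∫ ω in {ω | b ≤ Y 0 ω ^ 2}, Y 0 ω ^ 2 ∂P ≤ γ / 4 := by
    rw [truncatedSecondMoment, ← ofReal_integral_eq_lintegral_ofReal
      hL2.integrable_sq.integrableOn (ae_of_all _ fun ω => sq_nonneg _)] at htail
    exact (ENNReal.ofReal_le_ofReal_iff (by positivity)).1 htail
  have hee : 1 - γ / 4 ≤ -e := by
    have h1 : ∫ ω, (Y 0 ω ^ 2 + f (Y 0 ω)) ∂P ≤ ∫ ω in {ω | b ≤ Y 0 ω ^ 2}, Y 0 ω ^ 2 ∂P := by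
      rw [← integral_indicator hset]
      refine integral_mono (hL2.integrable_sq.add hfi) (hL2.integrable_sq.indicator hset)
        fun ω => ?_
      simp only [Set.indicator_apply, Set.mem_ofPred_eq, hf]
      split_ifs with h
      · rw [min_eq_right h]; linarith
      · rw [min_eq_left (not_le.1 h).le]; linarith
    rw [integral_add hL2.integrable_sq hfi] at h1
    linarith
  have hsub : ∀ i, HasSubgaussianMGF (fun ω => f (Y i ω) - e) ((‖(0 : ℝ) - -b‖₊ / 2) ^ 2) P := by
    intro i
    have := hasSubgaussianMGF_of_mem_Icc (hfm.comp (hY i)).aemeasurable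
      (ae_of_all P fun ω => hfb (Y i ω))
    have h2 : ∫ ω, (f ∘ Y i) ω ∂P = e := ((hid i).comp hfm).integral_eq
    rw [h2] at this
    exact this
  have hindf : iIndepFun (fun i ω => f (Y i ω) - e) P :=
    hind.comp (fun _ x => f x - e) fun _ => hfm.sub_const e
  have hk : ∀ k : ℕ, P {ω | ∑ i ∈ Finset.range k, min (Y i ω ^ 2) b ≤ (1 - γ / 2) * k} ≤
      ENNReal.ofReal (Real.exp (-(γ ^ 2 / (8 * b ^ 2))) ^ k) := by
    intro k
    have h1 := HasSubgaussianMGF.measure_sum_range_ge_le_of_iIndepFun hindf (n := k)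
      (fun i _ => hsub i) (ε := γ / 4 * k) (by positivity)
    have h2 : Real.exp (-(γ / 4 * k) ^ 2 / (2 * k * ((‖(0 : ℝ) - -b‖₊ / 2) ^ 2 : NNReal))) =
        Real.exp (-(γ ^ 2 / (8 * b ^ 2))) ^ k := by
      rw [← Real.exp_nat_mul]
      congr 1
      push_cast
      rw [zero_sub, neg_neg, Real.norm_of_nonneg hb.le]
      rcases Nat.eq_zero_or_pos k with rfl | hk0
      · simp
      · field_simp
        ring
    rw [h2] at h1
    rw [← ofReal_measureReal]
    refine ENNReal.ofReal_le_ofReal (le_trans (measureReal_mono fun ω hω => ?_) h1)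
    simp only [Set.mem_ofPred_eq, Finset.sum_sub_distrib, hf, Finset.sum_neg_distrib,
      Finset.sum_const, Finset.card_range, nsmul_eq_mul] at hω ⊢
    have h3 : (k : ℝ) * (1 - γ / 4) ≤ k * -e := by gcongr
    linarith
  have hU : {ω | ∃ k, m ≤ k ∧ ∑ i ∈ Finset.range k, min (Y i ω ^ 2) b ≤ (1 - γ / 2) * k} ⊆
      ⋃ i : ℕ, {ω | ∑ j ∈ Finset.range (i + m), min (Y j ω ^ 2) b ≤
        (1 - γ / 2) * (i + m : ℕ)} := by
    rintro ω ⟨k, hmk, hk⟩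
    refine Set.mem_iUnion.2 ⟨k - m, ?_⟩
    rw [Nat.sub_add_cancel hmk]
    exact hk
  exact (measure_mono hU).trans ((measure_iUnion_le _).trans (ENNReal.tsum_le_tsum fun i => hk _))

theorem tendsto_tsum_ofReal_pow_add {q : ℝ} (hq0 : 0 ≤ q) (hq1 : q < 1) :
    Tendsto (fun m : ℕ => ∑' i : ℕ, ENNReal.ofReal (q ^ (i + m))) atTop (𝓝 0) :=
  ENNReal.tendsto_sum_nat_add (fun n => ENNReal.ofReal (q ^ n))
    (summable_geometric_of_lt_one hq0 hq1).tsum_ofReal_ne_top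

end SampleVariance

/-! ### Rescaling of truncated second moments -/

section Scaling

variable {Ω : Type*} [MeasurableSpace Ω]

theorem log_log_natCast_pos {k : ℕ} (hk : 3 ≤ k) : 0 < Real.log (Real.log k) := by
  have hk' : (3 : ℝ) ≤ k := by exact_mod_cast hk
  refine Real.log_pos ((Real.lt_log_iff_exp_lt (by linarith)).2 ?_)
  linarith [Real.exp_one_lt_d9]

theorem sqrt_log_log_natCast_pos {k : ℕ} (hk : 3 ≤ k) :
    0 < √(2 * k * Real.log (Real.log k)) := by
  have := log_log_natCast_pos hk
  have hk' : (0 : ℝ) < k := by exact_mod_cast (by omega : 0 < k)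
  exact Real.sqrt_pos.2 (by positivity)

theorem truncatedSecondMoment_div {Y : Ω → ℝ} (P : Measure Ω) {c : ℝ} (hc : 0 < c) (x : ℝ) :
    truncatedSecondMoment (fun ω => Y ω / c) P x =
      ENNReal.ofReal (1 / c ^ 2) * truncatedSecondMoment Y P (c ^ 2 * x) := by
  have h : {ω | x ≤ (Y ω / c) ^ 2} = {ω | c ^ 2 * x ≤ Y ω ^ 2} := by
    ext ω
    simp only [Set.mem_ofPred_eq, div_pow]
    rw [le_div_iff₀ (by positivity), mul_comm]
  rw [truncatedSecondMoment, truncatedSecondMoment, h,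
    ← lintegral_const_mul' _ _ ENNReal.ofReal_ne_top]
  refine lintegral_congr fun ω => ?_
  rw [← ENNReal.ofReal_mul (by positivity)]
  congr 1
  field_simp

theorem HasUniformlyIntegrableSecondMoment.div_const {Laws : Set (Measure Ω)} {Y : Ω → ℝ}
    (h : HasUniformlyIntegrableSecondMoment Laws fun _ => Y) {c : ℝ} (hc : 0 < c) :
    HasUniformlyIntegrableSecondMoment Laws fun _ ω => Y ω / c := by
  unfold HasUniformlyIntegrableSecondMoment at h ⊢
  simp_rw [truncatedSecondMoment_div _ hc, ← ENNReal.mul_iSup]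
  have h1 : Tendsto (fun x : ℝ => c ^ 2 * x) atTop atTop :=
    tendsto_id.const_mul_atTop (by positivity)
  have h2 := ENNReal.Tendsto.const_mul (a := ENNReal.ofReal (1 / c ^ 2)) (h.comp h1)
    (Or.inr ENNReal.ofReal_ne_top)
  rwa [mul_zero] at h2

theorem lintegral_sq_le_truncatedSecondMoment {Y : Ω → ℝ} (hY : Measurable Y) (P : Measure Ω)
    [IsProbabilityMeasure P] (x : ℝ) :
    ∫⁻ ω, ENNReal.ofReal (Y ω ^ 2) ∂P ≤ ENNReal.ofReal x + truncatedSecondMoment Y P x := by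
  have h : ∫⁻ _, ENNReal.ofReal x ∂P = ENNReal.ofReal x := by simp
  rw [truncatedSecondMoment, ← lintegral_indicator (measurableSet_le measurable_const
    (hY.pow_const 2)), ← h, ← lintegral_add_left measurable_const]
  refine lintegral_mono fun ω => ?_
  by_cases hω : x ≤ Y ω ^ 2
  · rw [Set.indicator_of_mem (by exact hω)]
    exact le_add_self
  · exact (ENNReal.ofReal_le_ofReal (not_le.1 hω).le).trans le_self_add

end Scaling

/-! ### Constant normalisation, and comparison of events for the sample standard deviation -/

section UniformLIL

/-- On the exceedance event for the sample standard deviation, either the partial sums normalised by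
`c` exceed the boundary, or the truncated empirical second moment is small. -/
theorem lilExceedance_sampleStd_subset {Ω : Type*} {X : ℕ → Ω → ℝ} {c δ γ b : ℝ} (hc : 0 < c) (hδ : 0 < δ) (hγ1 : γ ≤ 1 / 10)
    (hγ : 0 < γ) (hγδ : γ ≤ δ / 10) {m : ℕ} (hm : 3 ≤ m)
    (hmk : ∀ k : ℕ, m ≤ k → (1 + γ) * √(2 * k * Real.log (Real.log k)) ≤ √(γ / 2) * k) :
    lilExceedance X (sampleStd X) δ m ⊆
      {ω | ∃ k, m ≤ k ∧ (1 + γ) * √(2 * k * Real.log (Real.log k)) ≤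
        |∑ i ∈ Finset.range k, X i ω / c|} ∪
      {ω | ∃ k, m ≤ k ∧
        ∑ i ∈ Finset.range k, min ((X i ω / c) ^ 2) b ≤ (1 - γ / 2) * k} := by
  intro ω hω
  obtain ⟨k, hk, hkω⟩ := exists_of_mem_lilExceedance hδ hω
  by_contra hcon
  rw [Set.mem_union, not_or] at hcon
  obtain ⟨h1, h2⟩ := hcon
  have h1 : |∑ i ∈ Finset.range k, X i ω / c| < (1 + γ) * √(2 * k * Real.log (Real.log k)) := by
    by_contra h
    exact h1 ⟨k, hk, not_lt.1 h⟩
  have h2 : (1 - γ / 2) * k < ∑ i ∈ Finset.range k, min ((X i ω / c) ^ 2) b := by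
    by_contra h
    exact h2 ⟨k, hk, not_lt.1 h⟩
  have hr := sqrt_log_log_natCast_pos (hm.trans hk)
  have hk0 : (0 : ℝ) < k := by exact_mod_cast (by omega : 0 < k)
  have hmean : ((∑ i ∈ Finset.range k, X i ω / c) / k) ^ 2 ≤ γ / 2 := by
    rw [← sq_abs, abs_div, Nat.abs_cast, ← Real.sq_sqrt (show 0 ≤ γ / 2 by positivity)]
    have := (div_le_iff₀ hk0).2 (h1.le.trans (hmk k hk))
    gcongr
  have hsq : 1 - γ / 2 ≤ (∑ i ∈ Finset.range k, (X i ω / c) ^ 2) / k := by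
    rw [le_div_iff₀ hk0]
    exact h2.le.trans (Finset.sum_le_sum fun i _ => min_le_left _ _)
  have hsv : (1 - γ) * c ^ 2 ≤ sampleVariance X k ω := by
    have h3 := sampleVariance_eq X (k := k) (by omega) ω
    have h4 : sampleVariance X k ω = ((∑ i ∈ Finset.range k, (X i ω / c) ^ 2) / k -
        ((∑ i ∈ Finset.range k, X i ω / c) / k) ^ 2) * c ^ 2 := by
      rw [h3]
      simp_rw [div_pow _ c]
      rw [← Finset.sum_div, ← Finset.sum_div]
      field_simp
    rw [h4]
    exact mul_le_mul_of_nonneg_right (by linarith) (sq_nonneg c)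
  -- Uses `(1 - γ)² ≤ 1 - γ`. Positivity of the sample deviation follows, so no quotient by zero
  -- occurs here.
  have hstd : (1 - γ) * c ≤ sampleStd X k ω := by
    refine Real.le_sqrt_of_sq_le (le_trans ?_ hsv)
    rw [mul_pow]
    gcongr
    nlinarith
  have hs0 : 0 < sampleStd X k ω := lt_of_lt_of_le (mul_pos (by linarith) hc) hstd
  have h5 := mul_lt_abs_of_ofReal_lt_div hs0 hr hkω
  rw [← Finset.sum_div, abs_div, abs_of_pos hc, div_lt_iff₀ hc] at h1
  have h6 : (1 + γ) * √(2 * k * Real.log (Real.log k)) * c ≤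
      (1 + δ / 2) * √(2 * k * Real.log (Real.log k)) * sampleStd X k ω := by
    have h7 : 1 + γ ≤ (1 + δ / 2) * (1 - γ) := by nlinarith
    calc _ ≤ (1 + δ / 2) * (1 - γ) * √(2 * k * Real.log (Real.log k)) * c := by gcongr
      _ = (1 + δ / 2) * √(2 * k * Real.log (Real.log k)) * ((1 - γ) * c) := by ring
      _ ≤ _ := by gcongr
  exact absurd (h5.trans_le' h6) (not_lt.2 h1.le)

variable {Ω : Type*} [MeasurableSpace Ω] {X : ℕ → Ω → ℝ} {Laws : Set (Measure Ω)}

theorem exists_iSup_evariance_le (hX : ∀ i, Measurable (X i)) (hLaws : Laws ⊆ centeredIIDLaws X)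
    (hUI : HasUniformlyIntegrableSecondMoment Laws fun _ => X 0) :
    ∃ σ : ℝ, 0 < σ ∧ (⨆ P ∈ Laws, evariance (X 0) P) ≤ ENNReal.ofReal (σ ^ 2) := by
  obtain ⟨x, hx⟩ := (ENNReal.tendsto_nhds_zero.1 hUI 1 one_pos).exists
  -- `|x|` comes from the region `X² < x`, and 1 from the tail beyond `x`.
  refine ⟨√(|x| + 1), by positivity, iSup₂_le fun P hP => ?_⟩
  obtain ⟨hprob, -, -, -, hmean⟩ := hLaws hP
  rw [evariance_eq_lintegral_ofReal, hmean, Real.sq_sqrt (by positivity),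
    ENNReal.ofReal_add (abs_nonneg x) one_pos.le, ENNReal.ofReal_one]
  simp only [sub_zero]
  refine (lintegral_sq_le_truncatedSecondMoment (hX 0) P x).trans (add_le_add ?_ ?_)
  · exact ENNReal.ofReal_le_ofReal (le_abs_self x)
  · exact (le_iSup₂ (f := fun P (_ : P ∈ Laws) => truncatedSecondMoment (X 0) P x) P hP).trans hx

theorem tendsto_iSup_measure_exists_sum_div_ge (hX : ∀ i, Measurable (X i))
    (hLaws : Laws ⊆ centeredIIDLaws X) (hL2 : ∀ P ∈ Laws, MemLp (X 0) 2 P) (c : Measure Ω → ℝ)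
    (hvar : ∀ P ∈ Laws, variance (X 0) P ≤ c P ^ 2)
    (hUI : HasUniformlyIntegrableSecondMoment Laws fun P ω => X 0 ω / c P) {δ : ℝ} (hδ : 0 < δ)
    (hδ1 : δ ≤ 1) :
    Tendsto (fun m : ℕ => ⨆ P ∈ Laws, P {ω | ∃ k, m ≤ k ∧
      (1 + δ) * √(2 * k * Real.log (Real.log k)) ≤ |∑ i ∈ Finset.range k, X i ω / c P|})
      atTop (𝓝 0) := by
  refine tendsto_iSup_measure_exists_sum_ge (Y := fun P i ω => X i ω / c P)
    (fun P _ i => (hX i).div_const _)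
    (fun P hP => (hLaws hP).2.1.comp (fun _ x => x / c P) fun _ => measurable_div_const' _)
    (fun P hP i => ((hLaws hP).2.2.1 i).comp (u := fun x => x / c P) (measurable_div_const' _))
    (fun P hP => ?_) (fun P hP => ?_) (fun P hP => ?_) hUI hδ hδ1
  · simpa only [div_eq_mul_inv] using (hL2 P hP).mul_const (c P)⁻¹
  · rw [integral_div, (hLaws hP).2.2.2.2 0, zero_div]
  · simp_rw [div_pow]
    rw [integral_div, ← variance_of_integral_eq_zero (hX 0).aemeasurable ((hLaws hP).2.2.2.2 0)]
    -- Also covers `c P = 0`, where division by zero returns 0.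
    exact div_le_one_of_le₀ (hvar P hP) (sq_nonneg _)

theorem uniformLIL_const (hX : ∀ i, Measurable (X i)) (hLaws : Laws ⊆ centeredIIDLaws X)
    (hUI : HasUniformlyIntegrableSecondMoment Laws fun _ => X 0) {σ : ℝ} (hσ : 0 < σ)
    (hvar : (⨆ P ∈ Laws, evariance (X 0) P) ≤ ENNReal.ofReal (σ ^ 2)) :
    UniformLIL Laws X fun _ _ => σ := by
  intro δ hδ
  have hev : ∀ P ∈ Laws, evariance (X 0) P ≤ ENNReal.ofReal (σ ^ 2) := fun P hP =>
    (le_iSup₂ (f := fun P (_ : P ∈ Laws) => evariance (X 0) P) P hP).trans hvar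
  have hL2 : ∀ P ∈ Laws, MemLp (X 0) 2 P := fun P hP => by
    have := (hLaws hP).1
    exact (evariance_lt_top_iff_memLp (hX 0).aestronglyMeasurable).1
      ((hev P hP).trans_lt ENNReal.ofReal_lt_top)
  have h := tendsto_iSup_measure_exists_sum_div_ge hX hLaws hL2 (fun _ => σ)
    (fun P hP => ENNReal.toReal_le_of_le_ofReal (sq_nonneg σ) (hev P hP)) (hUI.div_const hσ)
    -- `δ / 2` is what survives the passage to an index; the cap at 1 is required by the block
    -- estimate.
    (δ := min (δ / 2) 1) (lt_min (by positivity) one_pos) (min_le_right _ _)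
  refine tendsto_of_tendsto_of_tendsto_of_le_of_le' tendsto_const_nhds h
    (Eventually.of_forall fun _ => zero_le) ?_
  filter_upwards [eventually_ge_atTop 3] with m hm
  refine iSup₂_mono fun P hP => measure_mono fun ω hω => ?_
  obtain ⟨k, hmk, hk⟩ := exists_of_mem_lilExceedance hδ hω
  refine ⟨k, hmk, ?_⟩
  have hr := sqrt_log_log_natCast_pos (hm.trans hmk)
  have h1 := mul_lt_abs_of_ofReal_lt_div hσ hr hk
  rw [← Finset.sum_div, abs_div, abs_of_pos hσ, le_div_iff₀ hσ]
  refine le_trans ?_ h1.le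
  gcongr
  exact min_le_left _ _

theorem measure_lilExceedance_eq_zero {P : Measure Ω} (h : ∀ i, X i =ᵐ[P] 0)
    (s : ℕ → Ω → ℝ) {δ : ℝ} (hδ : 0 < δ) (m : ℕ) : P (lilExceedance X s δ m) = 0 := by
  refine measure_mono_null (t := {ω | ¬ ∀ i, X i ω = 0}) (fun ω hω h0 => ?_)
    (ae_all_iff.2 h)
  obtain ⟨k, -, hk⟩ := exists_of_mem_lilExceedance hδ hω
  simp [partialSum, h0] at hk

end UniformLIL

/-! ### Normalisation by the sample standard deviation -/

section SelfNormalized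

variable {Ω : Type*} [MeasurableSpace Ω] {X : ℕ → Ω → ℝ} {Laws : Set (Measure Ω)}

theorem uniformLIL_sampleStd (hX : ∀ i, Measurable (X i)) (hLaws : Laws ⊆ centeredIIDLaws X)
    (hL2 : ∀ P ∈ Laws, MemLp (X 0) 2 P)
    (hUI : HasUniformlyIntegrableSecondMoment Laws fun P ω => X 0 ω / √(variance (X 0) P)) :
    UniformLIL Laws X (sampleStd X) := by
  intro δ hδ
  set γ := min (δ / 10) (1 / 10) with hγ
  have hγ0 : 0 < γ := lt_min (by positivity) (by norm_num)
  have hγ1 : γ ≤ 1 / 10 := min_le_right _ _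
  obtain ⟨b, hb, hb0⟩ := ((ENNReal.tendsto_nhds_zero.1 hUI (ENNReal.ofReal (γ / 4))
    (by simpa using hγ0)).and (eventually_gt_atTop 0)).exists
  have h := tendsto_iSup_measure_exists_sum_div_ge hX hLaws hL2 (fun P => √(variance (X 0) P))
    (fun P _ => (Real.sq_sqrt (variance_nonneg _ _)).ge) hUI
    hγ0 (hγ1.trans (by norm_num))
  have h' := tendsto_tsum_ofReal_pow_add (Real.exp_pos (-(γ ^ 2 / (8 * b ^ 2)))).le
    (Real.exp_lt_one_iff.2 (neg_lt_zero.2 (by positivity)))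
  have hsum := h.add h'
  rw [add_zero] at hsum
  obtain ⟨m₀, hm₀⟩ := eventually_atTop.1
    (eventually_mul_sqrt_log_log_le (c := √(γ / 2)) (by positivity) (1 + γ))
  refine tendsto_of_tendsto_of_tendsto_of_le_of_le' tendsto_const_nhds hsum
    (Eventually.of_forall fun _ => zero_le) ?_
  filter_upwards [eventually_ge_atTop 3, eventually_ge_atTop m₀] with m hm hm'
  refine iSup₂_le fun P hP => ?_
  obtain ⟨hprob, hind, hid, -, hmean⟩ := hLaws hP
  -- For a degenerate law the rescaled second moment is 0 rather than 1, so the variance bound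
  -- fails; but then almost surely every sum vanishes and every quotient is 0.
  rcases (variance_nonneg (X 0) P).eq_or_lt with hv | hv
  · have h0 : X 0 =ᵐ[P] 0 := by
      have h1 : evariance (X 0) P = 0 := by rw [← ofReal_variance (hL2 P hP), ← hv]; simp
      have h2 := (evariance_eq_zero_iff (hX 0).aemeasurable).1 h1
      rw [hmean] at h2
      exact h2
    have hall : ∀ i, X i =ᵐ[P] 0 := fun i =>
      (hid i).symm.ae_snd (p := fun x => x = 0) (measurableSet_singleton 0) h0
    rw [measure_lilExceedance_eq_zero hall _ hδ]
    exact zero_le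
  set c := √(variance (X 0) P) with hc
  have hc0 : 0 < c := Real.sqrt_pos.2 hv
  have hsecond : 1 ≤ ∫ ω, (X 0 ω / c) ^ 2 ∂P := by
    simp_rw [div_pow]
    rw [integral_div, ← variance_of_integral_eq_zero (hX 0).aemeasurable (hmean 0), hc,
      Real.sq_sqrt hv.le, div_self hv.ne']
  have hL2' : MemLp (fun ω => X 0 ω / c) 2 P := by
    simpa only [div_eq_mul_inv] using (hL2 P hP).mul_const c⁻¹
  have hemp := measure_exists_sum_min_sq_le (Y := fun i ω => X i ω / c)
    (fun i => (hX i).div_const _) (hind.comp (fun _ x => x / c) fun _ => measurable_div_const' _)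
    (fun i => (hid i).comp (u := fun x => x / c) (measurable_div_const' _)) hL2' hsecond hb0 hγ0
    ((le_iSup₂ (f := fun P (_ : P ∈ Laws) =>
      truncatedSecondMoment (fun ω => X 0 ω / √(variance (X 0) P)) P b) P hP).trans hb) m
  refine (measure_mono (lilExceedance_sampleStd_subset (b := b) hc0 hδ hγ1 hγ0 (min_le_left _ _)
    hm fun k hk => hm₀ k (hm'.trans hk))).trans ((measure_union_le _ _).trans
    (add_le_add ?_ hemp))
  exact le_iSup₂ (f := fun P (_ : P ∈ Laws) => P {ω | ∃ k, m ≤ k ∧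
    (1 + γ) * √(2 * k * Real.log (Real.log k)) ≤
      |∑ i ∈ Finset.range k, X i ω / √(variance (X 0) P)|}) P hP

end SelfNormalized

theorem mainTheorem5 {Ω : Type*} [MeasurableSpace Ω] (X : ℕ → Ω → ℝ)
    (hX : ∀ i, Measurable (X i)) (Laws : Set (Measure Ω)) (hLaws : Laws ⊆ centeredIIDLaws X) :
    (HasUniformlyIntegrableSecondMoment Laws (fun _ => X 0) →
      (∃ σ : ℝ, 0 < σ ∧ (⨆ P ∈ Laws, evariance (X 0) P) ≤ ENNReal.ofReal (σ ^ 2)) ∧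
      ∀ σ : ℝ, 0 < σ → (⨆ P ∈ Laws, evariance (X 0) P) ≤ ENNReal.ofReal (σ ^ 2) →
        UniformLIL Laws X (fun _ _ => σ)) ∧
    ((∀ P ∈ Laws, MemLp (X 0) 2 P) →
      HasUniformlyIntegrableSecondMoment Laws (fun P ω => X 0 ω / √(variance (X 0) P)) →
      UniformLIL Laws X (sampleStd X)) := by
  refine ⟨fun hUI => ⟨exists_iSup_evariance_le hX hLaws hUI, fun σ hσ hvar =>
    uniformLIL_const hX hLaws hUI hσ hvar⟩, fun hL2 hUI => uniformLIL_sampleStd hX hLaws hL2 hUI⟩
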